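/- Let $p$ be an odd prime, and let $\delta_{p,q}$ denote the Kronecker delta, equal to $1$ if $p=q$ and $0$ otherwise. Congruences between rational numbers modulo a power $p^n$ are understood in the ring $\mathbb{Z}_p$ of $p$-adic integers, i.e. $x\equiv y\pmod{p^n}$ means $x-y\in p^n\mathbb{Z}_p$. (i) If $p\equiv1\pmod 3$, then $$\sum_{k=0}^{p-1}\frac{9k+2}{108^k}\binom{2k}{k}^2\binom{3k}{k}\equiv0\pmod{p^2}.$$ (ii) If $p\equiv1$ or $3\pmod 8$, then $$\sum_{k=0}^{p-1}\frac{16k+3}{256^k}\binom{2k}{k}^2\binom{4k}{2k}\equiv0\pmod{p^{2+\delta_{p,3}}}.$$ (iii) If $p\equiv1\pmod 4$, then $$\sum_{k=0}^{p-1}\frac{4k+1}{64^k}\binom{2k}{k}^3\equiv0\pmod{p^2}$$ and $$\sum_{k=0}^{p-1}\frac{36k+5}{12^{3k}}\binom{6k}{3k}\binom{3k}{k}\binom{2k}{k}\equiv0\pmod{p^{2+\delta_{p,5}}}.$$ -/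

import Mathlib

/-- The congruence `x ≡ y (mod p ^ n)` between rational numbers, read in the ring `ℤ_[p]` of
`p`-adic integers: `x - y` lies in `p ^ n ℤ_[p]` inside `ℚ_[p]`. -/
def PadicCongr (p : ℕ) [Fact p.Prime] (n : ℕ) (x y : ℚ) : Prop :=
  ∃ z : ℤ_[p], ((x - y : ℚ) : ℚ_[p]) = (p : ℚ_[p]) ^ n * (z : ℚ_[p])

/-- The Kronecker delta. -/
def kroneckerDelta (a b : ℕ) : ℕ := if a = b then 1 else 0

open Finset Polynomial

/-! Up to a constant, each sum is S(x) = `clausenSum p x` at x = -1/m, with m = 3, 4, 2, 6. A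
telescoping recurrence linking S(x + 2) to S(x) makes S vanish at even n < p. Since S(-1 - x) = S(x)
and p - 1 - n is again even, n - p is also a root. Once denominators prime to p are cleared, S is an
integral polynomial divisible by (X - n)(X - n + p). If p ∣ mn + 1, both factors are divisible by p
at -1/m, giving p²; if p² ∣ mn + 1, the first factor gives one more p. -/

/-- The product `∏_{j < k} (x - j) (x + 1 + j)`, equal to `k! ^ 2 * C(x, k) * C(x + k, k)`. -/
def pairedProd {R : Type*} [CommRing R] (x : R) (k : ℕ) : R :=
  ∏ j ∈ range k, (x - j) * (x + 1 + j)

lemma pairedProd_zero {R : Type*} [CommRing R] (x : R) : pairedProd x 0 = 1 := by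
  simp [pairedProd]

lemma pairedProd_succ {R : Type*} [CommRing R] (x : R) (k : ℕ) :
    pairedProd x (k + 1) = pairedProd x k * ((x - k) * (x + 1 + k)) := by
  simp [pairedProd, prod_range_succ]

lemma pairedProd_reflect {R : Type*} [CommRing R] (x : R) (k : ℕ) :
    pairedProd (-1 - x) k = pairedProd x k :=
  prod_congr rfl fun j _ => by ring

lemma pairedProd_eq_zero {R : Type*} [CommRing R] {n k : ℕ} (h : n < k) :
    pairedProd (n : R) k = 0 :=
  prod_eq_zero (mem_range.2 h) (by simp)

lemma map_pairedProd {R S : Type*} [CommRing R] [CommRing S] (f : R →+* S) (x : R) (k : ℕ) :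
    f (pairedProd x k) = pairedProd (f x) k := by
  simp [pairedProd, map_prod]

lemma pairedProd_add_one_succ {R : Type*} [CommRing R] (x : R) (k : ℕ) :
    pairedProd (x + 1) (k + 1) = pairedProd x k * ((x + 1 + k) * (x + 2 + k)) := by
  induction k with
  | zero => simp [pairedProd]; ring
  | succ k ih =>
    rw [pairedProd_succ, ih, pairedProd_succ]
    push_cast
    ring

lemma pairedProd_succ_eq_add_one {R : Type*} [CommRing R] (x : R) (k : ℕ) :
    pairedProd x (k + 1) = pairedProd (x + 1) k * ((x - k) * (x + 1 - k)) := by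
  -- The reflection x ↦ -1 - x turns the upward shift into a downward one.
  have h := pairedProd_add_one_succ (-1 - (x + 1)) k
  rw [pairedProd_reflect, show -1 - (x + 1) + 1 = -1 - x by ring, pairedProd_reflect] at h
  rw [h]
  ring

/-! ### The sum, its recurrence and its zeros -/

/-- The coefficient `C(2k, k) / ((-4) ^ k * k! ^ 2)`. -/
def centralCoeff (k : ℕ) : ℚ := (2 * k).choose k / ((-4) ^ k * (k.factorial : ℚ) ^ 2)

lemma cast_choose_two_mul_succ (k : ℕ) :
    ((k : ℚ) + 1) * ((2 * (k + 1)).choose (k + 1) : ℚ) =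
      2 * (2 * k + 1) * ((2 * k).choose k : ℚ) := by
  have h := Nat.succ_mul_centralBinom_succ k
  simp only [Nat.centralBinom] at h
  exact_mod_cast h

lemma centralCoeff_succ (k : ℕ) :
    2 * ((k : ℚ) + 1) ^ 3 * centralCoeff (k + 1) = -(2 * k + 1) * centralCoeff k := by
  have h := cast_choose_two_mul_succ k
  have hf : (k.factorial : ℚ) ≠ 0 := by exact_mod_cast k.factorial_ne_zero
  have hk : (k : ℚ) + 1 ≠ 0 := by positivity
  rw [centralCoeff, centralCoeff, Nat.factorial_succ, eq_div_of_mul_eq hk ((mul_comm _ _).trans h)]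
  push_cast
  field_simp
  ring

/-- The truncated sum `∑_{k < N} (k - x (x + 1)) C(2k, k) C(x, k) C(x + k, k) / (-4) ^ k`. -/
def clausenSum (N : ℕ) (x : ℚ) : ℚ :=
  ∑ k ∈ range N, (k - x * (x + 1)) * (centralCoeff k * pairedProd x k)

lemma clausenSum_reflect (N : ℕ) (x : ℚ) : clausenSum N (-1 - x) = clausenSum N x :=
  sum_congr rfl fun k _ => by rw [pairedProd_reflect]; ring

lemma clausenSum_succ (N : ℕ) (x : ℚ) : clausenSum (N + 1) x =
    clausenSum N x + (N - x * (x + 1)) * (centralCoeff N * pairedProd x N) :=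
  sum_range_succ _ _

/-- Creative telescoping: the right side is the boundary term, and it vanishes when x + 1 is a
natural number below N. -/
lemma clausenSum_recurrence (x : ℚ) (N : ℕ) :
    (x + 1) ^ 2 * clausenSum (N + 1) (x + 2) - (x + 2) ^ 2 * clausenSum (N + 1) x =
      (2 * x + 3) * (2 * N + 1) * (N - (x + 1) * (x + 2)) *
        (centralCoeff N * pairedProd (x + 1) N) := by
  induction N with
  | zero =>
    simp [clausenSum, pairedProd_zero, centralCoeff]
    ring
  | succ N ih =>
    have hk : (N : ℚ) + 1 ≠ 0 := by positivity
    have hc : centralCoeff (N + 1) = -(2 * N + 1) * centralCoeff N / (2 * ((N : ℚ) + 1) ^ 3) := by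
      rw [← centralCoeff_succ]
      field_simp
    have h2 := pairedProd_add_one_succ (x + 1) N
    rw [show x + 1 + 1 = x + 2 by ring] at h2
    rw [clausenSum_succ, clausenSum_succ _ x, h2,
      pairedProd_succ_eq_add_one x, pairedProd_succ (x + 1), hc]
    set A := clausenSum (N + 1) (x + 2)
    set B := clausenSum (N + 1) x
    have hA : (x + 1) ^ 2 * A = (2 * x + 3) * (2 * N + 1) * (N - (x + 1) * (x + 2)) *
        (centralCoeff N * pairedProd (x + 1) N) + (x + 2) ^ 2 * B := by linarith
    rw [mul_add, hA]
    push_cast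
    field_simp
    ring

lemma clausenSum_even_eq_zero {p n : ℕ} (hn : Even n) (h : n < p) : clausenSum p n = 0 := by
  obtain ⟨r, rfl⟩ := hn.exists_two_nsmul
  induction r with
  | zero =>
    -- At x = 0 the factor k - x(x + 1) kills the term k = 0, and `pairedProd` kills the others.
    refine sum_eq_zero fun k _ => ?_
    rcases Nat.eq_zero_or_pos k with rfl | hk
    · simp
    · have : pairedProd ((2 • 0 : ℕ) : ℚ) k = 0 := pairedProd_eq_zero (by simpa using hk)
      rw [this]; simp
  | succ r ih =>
    simp only [smul_eq_mul] at *
    obtain ⟨N, rfl⟩ : ∃ N, p = N + 1 := ⟨p - 1, by omega⟩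
    have hrec := clausenSum_recurrence ((2 * r : ℕ) : ℚ) N
    have hz : pairedProd (((2 * r : ℕ) : ℚ) + 1) N = 0 := by
      exact_mod_cast pairedProd_eq_zero (R := ℚ) (n := 2 * r + 1) (k := N) (by omega)
    rw [ih (even_two_mul r) (by omega), hz] at hrec
    have h1 : (((2 * r : ℕ) : ℚ) + 1) ^ 2 ≠ 0 := by positivity
    have h2 : ((2 * (r + 1) : ℕ) : ℚ) = ((2 * r : ℕ) : ℚ) + 2 := by push_cast; ring
    rw [h2]
    rw [mul_zero, sub_zero, mul_zero, mul_zero] at hrec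
    exact (mul_eq_zero.1 hrec).resolve_left h1

/-! ### Integral polynomial and its roots -/

/-- `clausenSum p`, with denominators cleared, as an integral polynomial. -/
noncomputable def clausenPoly (p : ℕ) : ℤ[X] :=
  ∑ k ∈ range p, ((k : ℤ[X]) - X * (X + 1)) *
    ((-1) ^ k * 4 ^ (p - 1 - k) * ((2 * k).choose k : ℤ[X]) *
      (((p - 1).factorial / k.factorial : ℕ) : ℤ[X]) ^ 2 * pairedProd X k)

lemma aeval_clausenPoly (p : ℕ) (x : ℚ) :
    aeval x (clausenPoly p) = 4 ^ (p - 1) * ((p - 1).factorial : ℚ) ^ 2 * clausenSum p x := by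
  rw [clausenPoly, map_sum, clausenSum, mul_sum]
  refine sum_congr rfl fun k hk => ?_
  have hkp : k ≤ p - 1 := by have := mem_range.1 hk; omega
  have hp : aeval x (pairedProd (X : ℤ[X]) k) = pairedProd x k := by
    simpa using map_pairedProd (aeval x : ℤ[X] →ₐ[ℤ] ℚ).toRingHom X k
  have hf : (k.factorial : ℚ) ≠ 0 := by exact_mod_cast k.factorial_ne_zero
  have hd : (((p - 1).factorial / k.factorial : ℕ) : ℚ) = (p - 1).factorial / k.factorial :=
    Nat.cast_div (Nat.factorial_dvd_factorial hkp) hf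
  have h4 : (4 : ℚ) ^ (p - 1) = 4 ^ (p - 1 - k) * 4 ^ k := by rw [← pow_add]; congr 1; omega
  have hs : ((-4 : ℚ)) ^ k = (-1) ^ k * 4 ^ k := by rw [← mul_pow]; norm_num
  have h1 : ((-1 : ℚ) ^ k) * (-1) ^ k = 1 := by rw [← mul_pow]; norm_num
  have hm : ((-1 : ℚ) ^ k) ≠ 0 := by positivity
  simp only [map_mul, map_sub, map_add, map_pow, map_natCast, map_neg, map_one, aeval_X, hp,
    map_ofNat, hd, centralCoeff, h4, hs]
  field_simp
  linear_combination (((k : ℚ) - x * (x + 1)) * (((2 * k).choose k : ℕ) : ℚ) * pairedProd x k) * h1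

lemma mul_X_sub_C_dvd {R : Type*} [CommRing R] [IsDomain R] {f : R[X]} {a b : R} (hab : a ≠ b)
    (ha : f.IsRoot a) (hb : f.IsRoot b) : (X - C a) * (X - C b) ∣ f := by
  obtain ⟨g, rfl⟩ := dvd_iff_isRoot.2 ha
  have hg : g.IsRoot b := by
    have h : (b - a) * g.eval b = 0 := by simpa [IsRoot] using hb
    exact (mul_eq_zero.1 h).resolve_left (sub_ne_zero.2 hab.symm)
  exact mul_dvd_mul_left _ (dvd_iff_isRoot.2 hg)

lemma clausenPoly_isRoot {p : ℕ} {a : ℤ} (h : clausenSum p a = 0) : (clausenPoly p).IsRoot a := by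
  have h1 := aeval_clausenPoly p (a : ℚ)
  rw [h, mul_zero] at h1
  have h2 : aeval ((algebraMap ℤ ℚ) a) (clausenPoly p) = 0 := by simpa using h1
  rw [aeval_algebraMap_apply] at h2
  simpa using h2

/-! ### p-adic divisibility at -1/m -/

lemma exists_padicInt_of_not_dvd (p : ℕ) [Fact p.Prime] {m : ℕ} (hm : ¬ p ∣ m) :
    ∃ u : ℤ_[p], (u : ℚ_[p]) = (m : ℚ_[p])⁻¹ := by
  have h : ‖(m : ℚ_[p])‖ = 1 := (Padic.norm_natCast_eq_one_iff).2
    (((Nat.Prime.coprime_iff_not_dvd Fact.out).2 hm))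
  exact ⟨⟨(m : ℚ_[p])⁻¹, by simp [h]⟩, rfl⟩

lemma padicCongr_zero_of_mul {p : ℕ} [Fact p.Prime] {n m : ℕ} {x : ℚ} (hm : ¬ p ∣ m)
    (h : PadicCongr p n (m * x) 0) : PadicCongr p n x 0 := by
  obtain ⟨z, hz⟩ := h
  obtain ⟨u, hu⟩ := exists_padicInt_of_not_dvd p hm
  have hm0 : (m : ℚ_[p]) ≠ 0 := by
    rw [Nat.cast_ne_zero]; rintro rfl; exact hm (dvd_zero p)
  refine ⟨u * z, ?_⟩
  push_cast at hz ⊢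
  rw [hu]
  field_simp
  linear_combination hz

lemma padicCongr_zero_natCast_mul {p : ℕ} [Fact p.Prime] {n : ℕ} {x : ℚ} (m : ℕ)
    (h : PadicCongr p n x 0) : PadicCongr p n (m * x) 0 := by
  obtain ⟨z, hz⟩ := h
  refine ⟨m * z, ?_⟩
  push_cast at hz ⊢
  linear_combination (m : ℚ_[p]) * hz

lemma padicCongr_clausenSum {p : ℕ} [Fact p.Prime] (hp : Odd p) {m n l e : ℕ} (hn : Even n)
    (hnp : n < p) (hm : ¬ p ∣ m) (hl : m * n + 1 = p ^ (1 + e) * l) :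
    PadicCongr p (2 + e) (clausenSum p (-1 / m)) 0 := by
  have hpp : p.Prime := Fact.out
  have hD : ¬ p ∣ 4 ^ (p - 1) * (p - 1).factorial ^ 2 := by
    rw [hpp.dvd_mul]
    rintro (h | h)
    · have h2 : p ∣ 2 ^ 2 := hpp.dvd_of_dvd_pow h
      have h3 := (Nat.prime_dvd_prime_iff_eq hpp Nat.prime_two).1 (hpp.dvd_of_dvd_pow h2)
      subst h3
      exact absurd hp (by decide)
    · have h2 := (hpp.dvd_factorial).1 (hpp.dvd_of_dvd_pow h)
      have := hpp.pos
      omega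
  refine padicCongr_zero_of_mul hD ?_
  have ha : (clausenPoly p).IsRoot (n : ℤ) :=
    clausenPoly_isRoot (by exact_mod_cast clausenSum_even_eq_zero hn hnp)
  have hb : (clausenPoly p).IsRoot ((n : ℤ) - p) := by
    refine clausenPoly_isRoot ?_
    have he : Even (p - 1 - n) := by
      rw [Nat.even_sub (by omega)]
      exact iff_of_true (Nat.Odd.sub_odd hp odd_one) hn
    have h0 := clausenSum_even_eq_zero (p := p) he (by omega)
    rw [← clausenSum_reflect] at h0
    rw [← h0]
    congr 1
    have : ((p - 1 - n : ℕ) : ℚ) = p - 1 - n := by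
      rw [Nat.cast_sub (by omega), Nat.cast_sub (by omega)]; simp
    rw [this]
    push_cast
    ring
  have hp0 : (p : ℤ) ≠ 0 := by exact_mod_cast hpp.ne_zero
  obtain ⟨g, hg⟩ := mul_X_sub_C_dvd (by intro h; apply hp0; linarith) ha hb
  have heval := aeval_clausenPoly p (-1 / m)
  obtain ⟨u, hu⟩ := exists_padicInt_of_not_dvd p hm
  have hm0 : (m : ℚ_[p]) ≠ 0 := by
    rw [Nat.cast_ne_zero]; rintro rfl; exact hm (dvd_zero p)
  -- The cofactor g has integer coefficients and -1/m is the p-adic integer -u, so g(-1/m) is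
  -- p-integral.
  have hgu : ((aeval (-1 / m : ℚ) g : ℚ) : ℚ_[p]) = ((aeval (-u) g : ℤ_[p]) : ℚ_[p]) := by
    have h1 := hom_eval₂ g (algebraMap ℤ ℚ) (Rat.castHom ℚ_[p]) (-1 / m)
    have h2 := hom_eval₂ g (algebraMap ℤ ℤ_[p]) PadicInt.Coe.ringHom (-u)
    have h3 : (Rat.castHom ℚ_[p]) (-1 / m : ℚ) = PadicInt.Coe.ringHom (-u) := by
      change ((-1 / m : ℚ) : ℚ_[p]) = ((-u : ℤ_[p]) : ℚ_[p])
      push_cast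
      rw [hu]
      ring
    rw [h3, Subsingleton.elim ((Rat.castHom ℚ_[p]).comp _)
      (PadicInt.Coe.ringHom.comp (algebraMap ℤ ℤ_[p])), ← h2] at h1
    exact h1
  -- The two linear factors are -1/m - n = -p^(1+e) l u and -1/m - n + p = p (1 - p^e l u).
  refine ⟨-l * u * (1 - p ^ e * l * u) * aeval (-u) g, ?_⟩
  have hl' : (m : ℚ_[p]) * n + 1 = p ^ (1 + e) * l := by exact_mod_cast hl
  push_cast
  rw [← hgu, hu]
  have hcast : ((4 ^ (p - 1) * ((p - 1).factorial : ℚ) ^ 2 * clausenSum p (-1 / m) : ℚ) : ℚ_[p]) =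
      ((-1 / m - n) * (-1 / m - (n - p)) * aeval (-1 / m : ℚ) g : ℚ) := by
    rw [← heval, hg]
    simp
  push_cast at hcast
  rw [sub_zero, hcast]
  have hn' : (n : ℚ_[p]) = (p ^ (1 + e) * l - 1) / m := by field_simp; linear_combination hl'
  rw [hn']
  field_simp
  ring

/-! ### The four sums as values at -1/m -/

lemma pairedProd_one_third (k : ℕ) : ((3 * k).factorial : ℚ) =
    (-27) ^ k * k.factorial * pairedProd (-1 / (3 : ℕ) : ℚ) k := by
  induction k with
  | zero => simp [pairedProd_zero]
  | succ k ih =>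
    rw [show 3 * (k + 1) = 3 * k + 1 + 1 + 1 by ring, pairedProd_succ]
    simp only [Nat.factorial_succ]
    push_cast at ih ⊢
    rw [ih, pow_succ]
    field_simp
    ring

lemma pairedProd_one_fourth (k : ℕ) : ((4 * k).factorial : ℚ) =
    (-64) ^ k * (2 * k).factorial * pairedProd (-1 / (4 : ℕ) : ℚ) k := by
  induction k with
  | zero => simp [pairedProd_zero]
  | succ k ih =>
    rw [show 4 * (k + 1) = 4 * k + 1 + 1 + 1 + 1 by ring, show 2 * (k + 1) = 2 * k + 1 + 1 by ring,
      pairedProd_succ]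
    simp only [Nat.factorial_succ]
    push_cast at ih ⊢
    rw [ih, pow_succ]
    field_simp
    ring

lemma pairedProd_one_half (k : ℕ) : ((2 * k).factorial : ℚ) ^ 2 =
    (-16) ^ k * (k.factorial : ℚ) ^ 2 * pairedProd (-1 / (2 : ℕ) : ℚ) k := by
  induction k with
  | zero => simp [pairedProd_zero]
  | succ k ih =>
    rw [show 2 * (k + 1) = 2 * k + 1 + 1 by ring, pairedProd_succ]
    simp only [Nat.factorial_succ]
    push_cast at ih ⊢
    rw [mul_pow, mul_pow, ih, pow_succ]
    field_simp
    ring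

lemma pairedProd_one_sixth (k : ℕ) : ((6 * k).factorial : ℚ) * k.factorial =
    (-432) ^ k * (3 * k).factorial * (2 * k).factorial * pairedProd (-1 / (6 : ℕ) : ℚ) k := by
  induction k with
  | zero => simp [pairedProd_zero]
  | succ k ih =>
    rw [show 6 * (k + 1) = 6 * k + 1 + 1 + 1 + 1 + 1 + 1 by ring,
      show 3 * (k + 1) = 3 * k + 1 + 1 + 1 by ring, show 2 * (k + 1) = 2 * k + 1 + 1 by ring,
      pairedProd_succ]
    simp only [Nat.factorial_succ]
    push_cast at ih ⊢
    rw [pow_succ]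
    field_simp at ih ⊢
    linear_combination (36 * (6 * (k : ℚ) + 1) * (6 * k + 2) * (6 * k + 3) * (6 * k + 4) *
      (6 * k + 5) * (6 * k + 6) * (k + 1)) * ih

lemma cast_choose_add (a b c : ℕ) (h : c = a + b) :
    (c.choose a : ℚ) = c.factorial / (a.factorial * b.factorial) := by
  subst h
  exact Nat.cast_add_choose ℚ

lemma sum_one_third (p : ℕ) :
    ∑ k ∈ range p, (9 * (k : ℚ) + 2) / 108 ^ k * ((2 * k).choose k : ℚ) ^ 2 *
      ((3 * k).choose k : ℚ) = (9 : ℕ) * clausenSum p (-1 / (3 : ℕ)) := by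
  rw [clausenSum, mul_sum]
  refine sum_congr rfl fun k _ => ?_
  have h := pairedProd_one_third k
  rw [centralCoeff, cast_choose_add k k (2 * k) (by ring),
    cast_choose_add k (2 * k) (3 * k) (by ring), h, show (108 : ℚ) ^ k = (-4) ^ k * (-27) ^ k by
      rw [← mul_pow]; norm_num]
  push_cast
  field_simp
  ring

lemma sum_one_fourth (p : ℕ) :
    ∑ k ∈ range p, (16 * (k : ℚ) + 3) / 256 ^ k * ((2 * k).choose k : ℚ) ^ 2 *
      ((4 * k).choose (2 * k) : ℚ) = (16 : ℕ) * clausenSum p (-1 / (4 : ℕ)) := by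
  rw [clausenSum, mul_sum]
  refine sum_congr rfl fun k _ => ?_
  have h := pairedProd_one_fourth k
  rw [centralCoeff, cast_choose_add k k (2 * k) (by ring),
    cast_choose_add (2 * k) (2 * k) (4 * k) (by ring), h,
    show (256 : ℚ) ^ k = (-4) ^ k * (-64) ^ k by rw [← mul_pow]; norm_num]
  push_cast
  field_simp
  ring

lemma sum_one_half (p : ℕ) :
    ∑ k ∈ range p, (4 * (k : ℚ) + 1) / 64 ^ k * ((2 * k).choose k : ℚ) ^ 3 =
      (4 : ℕ) * clausenSum p (-1 / (2 : ℕ)) := by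
  rw [clausenSum, mul_sum]
  refine sum_congr rfl fun k _ => ?_
  have h := pairedProd_one_half k
  rw [centralCoeff, pow_succ, cast_choose_add k k (2 * k) (by ring), div_pow, h,
    show (64 : ℚ) ^ k = (-4) ^ k * (-16) ^ k by rw [← mul_pow]; norm_num]
  push_cast
  field_simp
  ring

lemma sum_one_sixth (p : ℕ) :
    ∑ k ∈ range p, (36 * (k : ℚ) + 5) / 12 ^ (3 * k) * ((6 * k).choose (3 * k) : ℚ) *
      ((3 * k).choose k : ℚ) * ((2 * k).choose k : ℚ) =
        (36 : ℕ) * clausenSum p (-1 / (6 : ℕ)) := by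
  rw [clausenSum, mul_sum]
  refine sum_congr rfl fun k _ => ?_
  have hk : (k.factorial : ℚ) ≠ 0 := by exact_mod_cast k.factorial_ne_zero
  have h := eq_div_of_mul_eq hk (pairedProd_one_sixth k)
  rw [centralCoeff, cast_choose_add k k (2 * k) (by ring),
    cast_choose_add k (2 * k) (3 * k) (by ring), cast_choose_add (3 * k) (3 * k) (6 * k) (by ring),
    h, show (12 : ℚ) ^ (3 * k) = (-4) ^ k * (-432) ^ k by
      rw [← mul_pow, pow_mul]; norm_num]
  push_cast
  field_simp
  ring

/-! ### Choice of n for each residue class -/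

theorem corollary1p3 (p : ℕ) [Fact p.Prime] (hp : Odd p) :
    (p ≡ 1 [MOD 3] →
      PadicCongr p 2
        (∑ k ∈ Finset.range p,
          (9 * (k : ℚ) + 2) / 108 ^ k * ((2 * k).choose k : ℚ) ^ 2 * ((3 * k).choose k : ℚ)) 0) ∧
    (p ≡ 1 [MOD 8] ∨ p ≡ 3 [MOD 8] →
      PadicCongr p (2 + kroneckerDelta p 3)
        (∑ k ∈ Finset.range p,
          (16 * (k : ℚ) + 3) / 256 ^ k * ((2 * k).choose k : ℚ) ^ 2 *
            ((4 * k).choose (2 * k) : ℚ)) 0) ∧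
    (p ≡ 1 [MOD 4] →
      PadicCongr p 2
        (∑ k ∈ Finset.range p,
          (4 * (k : ℚ) + 1) / 64 ^ k * ((2 * k).choose k : ℚ) ^ 3) 0 ∧
      PadicCongr p (2 + kroneckerDelta p 5)
        (∑ k ∈ Finset.range p,
          (36 * (k : ℚ) + 5) / 12 ^ (3 * k) * ((6 * k).choose (3 * k) : ℚ) *
            ((3 * k).choose k : ℚ) * ((2 * k).choose k : ℚ)) 0) := by
  have hpp : p.Prime := Fact.out
  have hodd : p % 2 = 1 := Nat.odd_iff.1 hp
  have hp1 : 1 < p := hpp.one_lt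
  have h2 : ¬ p ∣ 2 := fun h => by
    have := (Nat.prime_dvd_prime_iff_eq hpp Nat.prime_two).1 h
    omega
  have h3 : p ≠ 3 → ¬ p ∣ 3 := fun hne h =>
    hne ((Nat.prime_dvd_prime_iff_eq hpp Nat.prime_three).1 h)
  refine ⟨fun h => ?_, fun h => ?_, fun h => ⟨?_, ?_⟩⟩
  · rw [sum_one_third]
    refine padicCongr_zero_natCast_mul _ ?_
    simp only [Nat.ModEq] at h
    exact padicCongr_clausenSum hp (n := (p - 1) / 3) (l := 1) (e := 0)
      (Nat.even_iff.2 (by omega)) (by omega) (h3 (by rintro rfl; omega))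
      (by rw [add_zero, pow_one]; omega)
  · rw [sum_one_fourth]
    refine padicCongr_zero_natCast_mul _ ?_
    have h4 : ¬ p ∣ 4 := fun hd => h2 (hpp.dvd_of_dvd_pow (n := 2) hd)
    simp only [Nat.ModEq] at h
    by_cases hp3 : p = 3
    · rw [kroneckerDelta, if_pos hp3]
      -- Here 4 · 2 + 1 = 3², so e = 1 gives the extra factor.
      exact padicCongr_clausenSum hp (n := 2) (l := 1) even_two (by omega) h4 (by rw [hp3]; rfl)
    rw [kroneckerDelta, if_neg hp3]
    rcases h with h | h
    · exact padicCongr_clausenSum hp (n := (p - 1) / 4) (l := 1)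
        (Nat.even_iff.2 (by omega)) (by omega) h4 (by rw [add_zero, pow_one]; omega)
    -- As 3p ≡ 1 mod 8, this n is an even integer.
    · exact padicCongr_clausenSum hp (n := (3 * p - 1) / 4) (l := 3)
        (Nat.even_iff.2 (by omega)) (by omega) h4 (by rw [add_zero, pow_one]; omega)
  · rw [sum_one_half]
    refine padicCongr_zero_natCast_mul _ ?_
    simp only [Nat.ModEq] at h
    exact padicCongr_clausenSum hp (n := (p - 1) / 2) (l := 1) (e := 0)
      (Nat.even_iff.2 (by omega)) (by omega) h2 (by rw [add_zero, pow_one]; omega)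
  · rw [sum_one_sixth]
    refine padicCongr_zero_natCast_mul _ ?_
    simp only [Nat.ModEq] at h
    have hp3 : p ≠ 3 := by rintro rfl; omega
    have h6 : ¬ p ∣ 2 * 3 := fun hd => (hpp.dvd_mul.1 hd).elim h2 (h3 hp3)
    have hmod : p % 3 ≠ 0 := fun h0 =>
      hp3 ((Nat.prime_dvd_prime_iff_eq Nat.prime_three hpp).1 (Nat.dvd_of_mod_eq_zero h0)).symm
    by_cases hp5 : p = 5
    · rw [kroneckerDelta, if_pos hp5]
      -- Here 6 · 4 + 1 = 5², so again e = 1.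
      exact padicCongr_clausenSum hp (n := 4) (l := 1) (by decide) (by omega) h6
        (by rw [hp5]; rfl)
    rw [kroneckerDelta, if_neg hp5]
    rcases (by omega : p % 12 = 1 ∨ p % 12 = 5) with h12 | h12
    · exact padicCongr_clausenSum hp (n := (p - 1) / 6) (l := 1)
        (Nat.even_iff.2 (by omega)) (by omega) h6 (by rw [add_zero, pow_one]; omega)
    -- As 5p ≡ 1 mod 12, this n is an even integer.
    · exact padicCongr_clausenSum hp (n := (5 * p - 1) / 6) (l := 5)
        (Nat.even_iff.2 (by omega)) (by omega) h6 (by rw [add_zero, pow_one]; omega)
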